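/- Let $k$ be an algebraically closed field of characteristic $p>0$; a variety over $k$ means a separated scheme of finite type over $k$. Let $f\colon T\to B$ be a dominant morphism (over $k$) of integral varieties over $k$, and let $K=k(B)$. Assume that the generic fibre $C=T_\eta$ is a regular, geometrically integral curve (i.e. of dimension one) over $K$. For $n\ge 0$ let $C^{(p^n)}$ denote the $n$-th Frobenius pullback of $C$, i.e. the base change of $C\to\operatorname{Spec}K$ along the morphism $\operatorname{Spec}K\to\operatorname{Spec}K$ given by $K\to K$, $c\mapsto c^{p^n}$. Assume that for some $n\ge 0$ the curve $C^{(p^n)}$ is rational over $K$, i.e. birational over $K$ to $\mathbb{P}^1_K$. Then: 1. $T$ is (inseparably) uniruled: there are an integral variety $Y$ over $k$ and a dominant rational map $Y\times_k\mathbb{P}^1_k \dashrightarrow T$ over $k$ whose associated extension of function fields $k(Y\times_k\mathbb{P}^1_k)\,|\,k(T)$ is finite and purely inseparable (possibly trivial); in particular $\dim Y=\dim T-1$. 2. If in addition $B$ is rational over $k$ (birational over $k$ to some $\mathbb{P}^m_k$), then $T$ is (inseparably) unirational: there are an integer $d\ge 0$ and a dominant rational map $\mathbb{P}^d_k\dashrightarrow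 T$ over $k$ whose associated extension of function fields is finite and purely inseparable (possibly trivial); in particular $d=\dim T$. -/

import Mathlib

universe u

open CategoryTheory CategoryTheory.Limits AlgebraicGeometry

namespace FrobeniusFibration

/-- Every residue field of a scheme over a field of characteristic `p` has characteristic `p`. -/
theorem charP_residueField {k : Type u} [Field k] (p : ℕ) [CharP k p] {X : Scheme.{u}}
    (sX : X ⟶ Spec (.of k)) (x : X) : CharP (X.residueField x) p :=
  charP_of_injective_ringHom
    (f := (Spec.preimage (X.fromSpecResidueField x ≫ sX)).hom) (RingHom.injective _) p

/-- The structure morphism `C^(p^n) ⟶ Spec K` of the `n`-th iterated Frobenius pullback of a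
`K`-scheme `C`: the base change of `C ⟶ Spec K` along the morphism `Spec K ⟶ Spec K`
given by the `p^n`-power map of `K`. -/
noncomputable def frobeniusPullback (p n : ℕ) {K : CommRingCat.{u}} [ExpChar K p]
    {C : Scheme.{u}} (sC : C ⟶ Spec K) :
    pullback sC (Spec.map (CommRingCat.ofHom (iterateFrobenius K p n))) ⟶ Spec K :=
  pullback.snd sC (Spec.map (CommRingCat.ofHom (iterateFrobenius K p n)))

/-- A scheme is regular if all its local rings are regular. -/
def IsRegular (X : Scheme.{u}) : Prop :=
  ∀ x : X, IsRegularLocalRing (X.presheaf.stalk x)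

theorem genericPoint_mem_domain {X Y : Scheme.{u}} [IrreducibleSpace X] (f : X.PartialMap Y) :
    genericPoint X ∈ f.domain :=
  (genericPoint_spec X).mem_open_set_iff f.domain.isOpen |>.mpr
    (by simpa using f.dense_domain.nonempty)

/-- The homomorphism induced by a partial map `f : X ⇢ Y` from the local ring of `Y` at the
image of the generic point of `X` to the function field of `X`. For dominant `f` and
integral `Y` the source is the function field of `Y`. -/
noncomputable def functionFieldMap {X Y : Scheme.{u}} [IrreducibleSpace X] (f : X.PartialMap Y) :
    Y.presheaf.stalk (f.hom ⟨genericPoint X, genericPoint_mem_domain f⟩) ⟶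
      f.domain.toScheme.presheaf.stalk ⟨genericPoint X, genericPoint_mem_domain f⟩ :=
  f.hom.stalkMap ⟨genericPoint X, genericPoint_mem_domain f⟩

/-- A ring homomorphism (in practice of fields) that makes its target a finite purely inseparable
extension of its source. -/
def IsFinitePurelyInseparable {F E : Type u} [CommRing F] [CommRing E] (φ : F →+* E) : Prop :=
  φ.Finite ∧ letI := φ.toAlgebra; IsPurelyInseparable F E

/-- Let `X` and `Y` be schemes over `S` with `X` irreducible. There is a dominant rational map
`X ⇢ Y` over `S`, generically finite and purely inseparable, i.e. the extension of
function fields is finite and purely inseparable (possibly trivial). -/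
def PurelyInseparablyDominates {S X Y : Scheme.{u}} [IrreducibleSpace X]
    (sX : X ⟶ S) (sY : Y ⟶ S) : Prop :=
  ∃ f : X.PartialMap Y, IsDominant f.hom ∧ f.hom ≫ sY = f.domain.ι ≫ sX ∧
    IsFinitePurelyInseparable (functionFieldMap f).hom

/-- The variety `T` over `k` is (inseparably) uniruled: there are an integral variety `Y` over `k`
and a dominant, generically finite, purely inseparable rational map over `k` from `Y × ℙ¹`
to `T` (so `dim Y = dim T - 1`). As `Y × 𝔸¹` is a dense open subscheme of `Y × ℙ¹`, the two
have the same rational maps, and we use `Y × 𝔸¹`. -/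
def IsInseparablyUniruled {k : Type u} [Field k] {T : Scheme.{u}}
    (sT : T ⟶ Spec (.of k)) : Prop :=
  ∃ (Y : Scheme.{u}) (sY : Y ⟶ Spec (.of k)) (_ : IsIntegral Y),
    IsSeparated sY ∧ LocallyOfFiniteType sY ∧ QuasiCompact sY ∧
      PurelyInseparablyDominates ((𝔸(PUnit.{u + 1}; Y) ↘ Y) ≫ sY) sT

/-- The variety `T` over `k` is (inseparably) unirational: there is a dominant, generically finite,
purely inseparable rational map over `k` from a finite-dimensional affine (equivalently,
projective) space over `k` to `T`. -/
def IsInseparablyUnirational {k : Type u} [Field k] {T : Scheme.{u}}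
    (sT : T ⟶ Spec (.of k)) : Prop :=
  ∃ (ι : Type u) (_ : Finite ι),
    PurelyInseparablyDominates (𝔸(ι; Spec (.of k)) ↘ Spec (.of k)) sT

end FrobeniusFibration

/-!
Let `C' = C^(p^n)`, birational to `𝔸ᴺ` over `K`, so that `k(C') = K(t₁, …, t_N)`. The projection
`C' ⟶ C` embeds `k(T) = k(C)` into `k(C')`, while the relative Frobenius `C ⟶ C'` embeds `k(C')`
into `k(C)`, and the composite is the `p^n`-power map of `k(C')`. Hence `k(C')^(p^n) ⊆ k(T) ⊆
k(C')`, and `k(C')`, being finitely generated, is finite and purely inseparable over `k(T)`. The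
projection is only semilinear for the Frobenius of `K`, so `𝔸ᴺ` over `B`, a model of `C'`, has to
be regarded as a `k`-scheme through the structure morphism of `B` followed by the Frobenius of
`k`, which is an isomorphism as `k` is perfect.

Function fields enter as dominant preimmersions `Spec E ⟶ X` with `E` a field. Such a morphism is
the inclusion of the generic point, and can be carried along open immersions, birational
equivalences and the passage from `𝔸ᴺ` over `B` to its generic fibre, without choosing
isomorphisms of stalks.
-/

namespace FrobeniusFibration

section GenericPoint

theorem apply_genericPoint {X Y : Scheme.{u}} [IrreducibleSpace X] [IrreducibleSpace Y]
    (f : X ⟶ Y) [IsDominant f] : f (genericPoint X) = genericPoint Y := by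
  refine IsGenericPoint.eq (S := Set.univ) ?_ (genericPoint_spec Y)
  simpa [f.denseRange.closure_range] using (genericPoint_spec X).image f.continuous

theorem isDominant_of_genericPoint_mem_range {X Y : Scheme.{u}} [IrreducibleSpace Y] {f : X ⟶ Y}
    (h : genericPoint Y ∈ Set.range f) : IsDominant f :=
  ⟨(dense_iff_closure_eq.mpr (genericPoint_spec Y)).mono (Set.singleton_subset_iff.mpr h)⟩

theorem isDominant_of_isOpenImmersion {X Y : Scheme.{u}} [Nonempty X] [IrreducibleSpace Y]
    (f : X ⟶ Y) [IsOpenImmersion f] : IsDominant f :=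
  ⟨f.isOpenEmbedding.isOpen_range.dense (Set.range_nonempty _)⟩

theorem isDominant_of_comp_isPreimmersion {X Y Z : Scheme.{u}} (f : X ⟶ Y) (g : Y ⟶ Z)
    [IsPreimmersion g] [IsDominant (f ≫ g)] : IsDominant f := by
  refine ⟨g.isEmbedding.isInducing.dense_iff.mpr fun y ↦ ?_⟩
  rw [← Set.range_comp, ← TopCat.coe_comp, ← Scheme.Hom.comp_base]
  exact (f ≫ g).denseRange _

theorem isDominant_fromSpecStalk_genericPoint (X : Scheme.{u}) [IrreducibleSpace X] :
    IsDominant (X.fromSpecStalk (genericPoint X)) :=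
  isDominant_of_genericPoint_mem_range ⟨_, Scheme.fromSpecStalk_closedPoint⟩

theorem isDominant_fiberι_genericPoint {T B : Scheme.{u}} [IrreducibleSpace T]
    [IrreducibleSpace B] (f : T ⟶ B) [IsDominant f] : IsDominant (f.fiberι (genericPoint B)) :=
  isDominant_of_genericPoint_mem_range (f.range_fiberι _ ▸ apply_genericPoint f)

theorem surjective_of_isField {X : Scheme.{u}} [Nonempty X] {K : CommRingCat.{u}} (hK : IsField K)
    (f : X ⟶ Spec K) : Surjective f :=
  let := hK.toField
  have : Subsingleton (Spec K) := inferInstanceAs (Subsingleton (PrimeSpectrum K))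
  ⟨Function.surjective_to_subsingleton _⟩

theorem apply_eq_genericPoint {E : CommRingCat.{u}} (hE : IsField E) {X : Scheme.{u}}
    [IrreducibleSpace X] (f : Spec E ⟶ X) [IsDominant f] (z : Spec E) : f z = genericPoint X := by
  let := hE.toField
  rw [← apply_genericPoint f]
  exact congrArg f (Subsingleton.elim (α := PrimeSpectrum E) _ _)

theorem exists_comp_fromSpecResidueField_eq {E : CommRingCat.{u}} (hE : IsField E)
    {X : Scheme.{u}} [IrreducibleSpace X] (f : Spec E ⟶ X) [IsDominant f] :
    ∃ g : Spec E ⟶ Spec (X.residueField (genericPoint X)),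
      g ≫ X.fromSpecResidueField (genericPoint X) = f := by
  let := hE.toField
  rw [← apply_eq_genericPoint hE f (IsLocalRing.closedPoint E)]
  exact ⟨_, Scheme.descResidueField_stalkClosedPointTo_fromSpecResidueField E X f⟩

theorem exists_SpecMap_comp_fromSpecStalk_eq {E : CommRingCat.{u}} (hE : IsField E)
    {X : Scheme.{u}} [IrreducibleSpace X] (f : Spec E ⟶ X) [IsDominant f] :
    ∃ ψ : X.presheaf.stalk (genericPoint X) ⟶ E,
      Spec.map ψ ≫ X.fromSpecStalk (genericPoint X) = f := by
  let := hE.toField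
  rw [← apply_eq_genericPoint hE f (IsLocalRing.closedPoint E)]
  exact ⟨Scheme.stalkClosedPointTo f, Scheme.Spec_stalkClosedPointTo_fromSpecStalk f⟩

end GenericPoint

section Frobenius

variable (p n : ℕ)

/-- The `n`-th iterate of the absolute Frobenius of an affine scheme of exponential
characteristic `p`. -/
noncomputable abbrev specFrobenius (R : CommRingCat.{u}) [ExpChar R p] : Spec R ⟶ Spec R :=
  Spec.map (CommRingCat.ofHom (iterateFrobenius R p n))

theorem specFrobenius_comp {R S : CommRingCat.{u}} [ExpChar R p] [ExpChar S p]
    (g : Spec S ⟶ Spec R) : specFrobenius p n S ≫ g = g ≫ specFrobenius p n R := by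
  obtain ⟨φ, rfl⟩ := Spec.map_surjective g
  rw [specFrobenius, specFrobenius, ← Spec.map_comp, ← Spec.map_comp]
  congr 1
  ext x
  exact (RingHom.map_iterateFrobenius φ.hom p x n).symm

theorem isIso_specFrobenius (R : CommRingCat.{u}) [ExpChar R p] [PerfectRing R p] :
    IsIso (specFrobenius p n R) := by
  have : IsIso (CommRingCat.ofHom (iterateFrobenius R p n)) :=
    (ConcreteCategory.isIso_iff_bijective _).mpr (bijective_iterateFrobenius R p n)
  exact inferInstanceAs (IsIso (Spec.map _))

variable {p n}

theorem expChar_of_hom {k : CommRingCat.{u}} (hk : IsField k) [ExpChar k p] {R : CommRingCat.{u}}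
    [Nontrivial R] (g : Spec R ⟶ Spec k) : ExpChar R p :=
  let := hk.toField
  expChar_of_injective_ringHom (Spec.preimage g).hom.injective p

theorem range_le_range_of_SpecMap_comp_eq {E F L : CommRingCat.{u}} (hE : IsField E)
    (hF : IsField F) [Nontrivial L] {C : Scheme.{u}} {g : Spec E ⟶ C} [SurjectiveOnStalks g]
    {c : Spec F ⟶ C} {φ : E ⟶ L} {ψ : F ⟶ L} (h : Spec.map ψ ≫ c = Spec.map φ ≫ g) :
    φ.hom.range ≤ ψ.hom.range := by
  let := hE.toField
  let := hF.toField
  obtain ⟨z⟩ : Nonempty (Spec L) := inferInstanceAs (Nonempty (PrimeSpectrum L))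
  have hz : c (IsLocalRing.closedPoint F) = g (IsLocalRing.closedPoint E) := by
    trans (Spec.map ψ ≫ c) z
    · exact congrArg c (Subsingleton.elim (α := PrimeSpectrum F) _ _)
    · exact h ▸ congrArg g (Subsingleton.elim (α := PrimeSpectrum E) _ _)
  obtain ⟨ζ, hζ⟩ : ∃ ζ : C.presheaf.stalk (g (IsLocalRing.closedPoint E)) ⟶ F,
      Spec.map ζ ≫ C.fromSpecStalk _ = c := by
    rw [← hz]
    exact ⟨Scheme.stalkClosedPointTo c, Scheme.Spec_stalkClosedPointTo_fromSpecStalk c⟩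
  have hγ : Function.Surjective (Scheme.stalkClosedPointTo g) :=
    (ConcreteCategory.bijective_of_isIso (stalkClosedPointIso E).hom).2.comp
      (g.stalkMap_surjective _)
  have hcomp : ζ ≫ ψ = Scheme.stalkClosedPointTo g ≫ φ := by
    apply Spec.map_injective
    rw [← cancel_mono (C.fromSpecStalk _), Spec.map_comp, Spec.map_comp, Category.assoc,
      Category.assoc, hζ, Scheme.Spec_stalkClosedPointTo_fromSpecStalk, h]
  rintro _ ⟨x, rfl⟩
  obtain ⟨y, rfl⟩ := hγ x
  exact ⟨ζ y, congrArg (fun χ ↦ χ.hom y) hcomp⟩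

theorem pow_mem_range_of_isPullback {K E F : CommRingCat.{u}}
    [ExpChar K p] [ExpChar E p] [ExpChar F p] (hE : IsField E) (hF : IsField F)
    {T B C' : Scheme.{u}} {f : T ⟶ B} {i : Spec K ⟶ B} [Mono i]
    {a : C' ⟶ T} {b : C' ⟶ Spec K} (h : IsPullback a b f (specFrobenius p n K ≫ i))
    {g : Spec E ⟶ C'} [SurjectiveOnStalks g] {ψ : F ⟶ E} {τ : Spec F ⟶ T}
    (hτ : Spec.map ψ ≫ τ = g ≫ a) {l : Spec F ⟶ Spec K} (hl : l ≫ i = τ ≫ f) (x : E) :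
    x ^ p ^ n ∈ ψ.hom.range := by
  -- The relative Frobenius of `Spec F` over `Spec K`.
  let c : Spec F ⟶ C' := h.lift (specFrobenius p n F ≫ τ) l (by
    rw [Category.assoc, ← hl, ← Category.assoc, specFrobenius_comp, Category.assoc])
  have hc : Spec.map ψ ≫ c = specFrobenius p n E ≫ g := by
    apply h.hom_ext
    · rw [Category.assoc, Category.assoc, IsPullback.lift_fst, ← hτ, ← Category.assoc,
        ← specFrobenius_comp, Category.assoc]
    · rw [Category.assoc, Category.assoc, IsPullback.lift_snd, specFrobenius_comp,
        ← cancel_mono i, Category.assoc, hl, ← Category.assoc, hτ, Category.assoc, h.w]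
      simp only [Category.assoc]
  have := hE.nontrivial
  exact range_le_range_of_SpecMap_comp_eq hE hF hc ⟨x, rfl⟩

end Frobenius

section PartialMap

theorem isFinitePurelyInseparable_of_pow_mem_range {p n : ℕ} {F E : Type u} [CommRing F]
    [CommRing E] [ExpChar F p] (hF : IsField F) (hE : IsField E) {φ : F →+* E}
    (hφ : φ.EssFiniteType) (h : ∀ x : E, x ^ p ^ n ∈ φ.range) : IsFinitePurelyInseparable φ := by
  let := hF.toField
  let := hE.toField
  let := φ.toAlgebra
  have : Algebra.EssFiniteType F E := hφ
  have : IsPurelyInseparable F E :=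
    (isPurelyInseparable_iff_pow_mem F p).mpr fun x ↦ ⟨n, h x⟩
  obtain ⟨s, hs⟩ := IntermediateField.fg_top F E
  have := IntermediateField.finiteDimensional_adjoin (K := F) (S := (s : Set E))
    fun x _ ↦ Algebra.IsIntegral.isIntegral x
  rw [hs] at this
  exact ⟨Module.Finite.equiv IntermediateField.topEquiv.toLinearEquiv, ‹_›⟩

theorem pow_mem_range_of_iso {F E F' E' : CommRingCat.{u}} {φ : F ⟶ E} {φ' : F' ⟶ E'}
    (e : Arrow.mk φ ≅ Arrow.mk φ') {q : ℕ} (h : ∀ x : E', x ^ q ∈ φ'.hom.range) (x : E) :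
    x ^ q ∈ φ.hom.range := by
  obtain ⟨y, hy⟩ := h (e.hom.right x)
  refine ⟨e.inv.left y, ?_⟩
  calc φ (e.inv.left y) = e.inv.right (φ' y) := congrArg (fun χ ↦ χ.hom y) e.inv.w
    _ = (e.hom.right ≫ e.inv.right) x ^ q := by
      rw [CommRingCat.comp_apply, ← map_pow]
      exact congrArg e.inv.right hy
    _ = x ^ q := by rw [← Arrow.comp_right, e.hom_inv_id]; rfl

-- The stalks in `functionFieldMap` are those at `P.hom (genericPoint X)` and of `P.domain`, so they
-- are only isomorphic to the function fields of `T` and `X`.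
theorem nonempty_iso_functionFieldMap {X T : Scheme.{u}} [IrreducibleSpace X] [IrreducibleSpace T]
    (P : X.PartialMap T) [IsDominant P.hom] {ψ : T.functionField ⟶ X.functionField}
    (hψ : Spec.map ψ ≫ T.fromSpecStalk _ =
      P.domain.fromSpecStalkOfMem _ (genericPoint_mem_domain P) ≫ P.hom) :
    Nonempty (Arrow.mk (functionFieldMap P) ≅ Arrow.mk ψ) := by
  let x₀ : P.domain.toScheme := ⟨genericPoint X, genericPoint_mem_domain P⟩
  have : Nonempty P.domain.toScheme := ⟨x₀⟩
  have : IrreducibleSpace P.domain.toScheme := P.domain.ι.isOpenEmbedding.irreducibleSpace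
  have hx₀ : genericPoint P.domain.toScheme = x₀ :=
    P.domain.ι.injective (genericPoint_eq_of_isOpenImmersion _)
  have hPx₀ : P.hom x₀ = genericPoint T := by
    rw [← hx₀, apply_genericPoint P.hom]
  let s := T.presheaf.stalkCongr (Inseparable.of_eq hPx₀)
  have hs : Spec.map s.hom ≫ T.fromSpecStalk (P.hom x₀) = T.fromSpecStalk (genericPoint T) :=
    Scheme.SpecMap_stalkSpecializes_fromSpecStalk (Inseparable.of_eq hPx₀).symm.specializes
  let i : X.functionField ≅ P.domain.toScheme.presheaf.stalk x₀ :=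
    (asIso (P.domain.ι.stalkMap x₀) :)
  have hi : Spec.map i.inv ≫ P.domain.toScheme.fromSpecStalk x₀ =
      P.domain.fromSpecStalkOfMem _ (genericPoint_mem_domain P) := rfl
  refine ⟨Arrow.isoMk s i.symm ?_⟩
  suffices s.hom ≫ ψ = P.hom.stalkMap x₀ ≫ i.inv from this
  apply Spec.map_injective
  rw [← cancel_mono (T.fromSpecStalk _), Spec.map_comp, Spec.map_comp, Category.assoc,
    Category.assoc, hs, hψ, Scheme.SpecMap_stalkMap_fromSpecStalk, ← hi, Category.assoc]

variable {S X T : Scheme.{u}} [IsIntegral X] [IsIntegral T]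

theorem exists_partialMap_of_functionField_hom {sX : X ⟶ S} {sT : T ⟶ S} [LocallyOfFiniteType sT]
    {ψ : T.functionField ⟶ X.functionField}
    (hψ : (Spec.map ψ ≫ T.fromSpecStalk _) ≫ sT = X.fromSpecStalk _ ≫ sX) :
    ∃ P : X.PartialMap T, IsDominant P.hom ∧ P.hom ≫ sT = P.domain.ι ≫ sX ∧
      Nonempty (Arrow.mk (functionFieldMap P) ≅ Arrow.mk ψ) := by
  let P := Scheme.PartialMap.ofFromSpecStalk sX sT _ hψ
  have hP : P.domain.fromSpecStalkOfMem _ (genericPoint_mem_domain P) ≫ P.hom =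
      Spec.map ψ ≫ T.fromSpecStalk _ :=
    Scheme.PartialMap.fromSpecStalkOfMem_ofFromSpecStalk sX sT _ hψ
  have := surjective_of_isField (Field.toIsField T.functionField) (Spec.map ψ)
  have := isDominant_fromSpecStalk_genericPoint T
  have : IsDominant (P.domain.fromSpecStalkOfMem _ (genericPoint_mem_domain P) ≫ P.hom) :=
    hP ▸ inferInstance
  have : IsDominant P.hom := .of_comp (P.domain.fromSpecStalkOfMem _ (genericPoint_mem_domain P)) _
  exact ⟨P, ‹_›, Scheme.PartialMap.ofFromSpecStalk_comp sX sT _ hψ,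
    nonempty_iso_functionFieldMap P hP.symm⟩

theorem purelyInseparablyDominates_of_pow_mem_range {k : CommRingCat.{u}} (hk : IsField k)
    {p n : ℕ} [ExpChar k p] {sX : X ⟶ Spec k} {sT : T ⟶ Spec k} [LocallyOfFiniteType sX]
    [LocallyOfFiniteType sT] {ψ : T.functionField ⟶ X.functionField}
    (hψ : (Spec.map ψ ≫ T.fromSpecStalk _) ≫ sT = X.fromSpecStalk _ ≫ sX)
    (hpow : ∀ x : X.functionField, x ^ p ^ n ∈ ψ.hom.range) :
    PurelyInseparablyDominates sX sT := by
  obtain ⟨P, hdom, hP, ⟨e⟩⟩ := exists_partialMap_of_functionField_hom hψ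
  refine ⟨P, hdom, hP, ?_⟩
  have hF : IsField (Arrow.mk (functionFieldMap P)).left :=
    (Arrow.leftFunc.mapIso e).commRingCatIsoToRingEquiv.toMulEquiv.isField
      (Field.toIsField T.functionField)
  have hE : IsField (Arrow.mk (functionFieldMap P)).right :=
    (Arrow.rightFunc.mapIso e).commRingCatIsoToRingEquiv.toMulEquiv.isField
      (Field.toIsField X.functionField)
  have := hF.nontrivial
  have : ExpChar (Arrow.mk (functionFieldMap P)).left p :=
    expChar_of_hom hk (T.fromSpecStalk (P.hom ⟨genericPoint X, genericPoint_mem_domain P⟩) ≫ sT)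
  have : LocallyOfFiniteType (P.hom ≫ sT) := hP ▸ inferInstance
  have : LocallyOfFiniteType P.hom := locallyOfFiniteType_of_comp P.hom sT
  exact isFinitePurelyInseparable_of_pow_mem_range hF hE (LocallyOfFiniteType.stalkMap P.hom _)
    (pow_mem_range_of_iso e hpow)

end PartialMap

section Birational

theorem birationalOver_iff_exists_isOpenImmersion {S X Y : Scheme.{u}} {sX : X ⟶ S} {sY : Y ⟶ S} :
    Scheme.BirationalOver sX sY ↔ ∃ (U : Scheme.{u}) (i : U ⟶ X) (j : U ⟶ Y),
      IsOpenImmersion i ∧ IsDominant i ∧ IsOpenImmersion j ∧ IsDominant j ∧ i ≫ sX = j ≫ sY := by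
  constructor
  · rintro ⟨π, hπ⟩
    have := Opens.isDominant_ι π.dense_source
    have := Opens.isDominant_ι π.dense_target
    exact ⟨π.source, π.source.ι, π.iso.hom ≫ π.target.ι, inferInstance, inferInstance,
      inferInstance, inferInstance, ((Category.assoc _ _ _).trans hπ).symm⟩
  · rintro ⟨U, i, j, _, _, _, _, h⟩
    exact (i.birationalOver sX _ rfl).symm.trans (j.birationalOver sY _ h.symm)

theorem birationalOver_comp {S S' X Y : Scheme.{u}} {sX : X ⟶ S} {sY : Y ⟶ S}
    (h : Scheme.BirationalOver sX sY) (t : S ⟶ S') :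
    Scheme.BirationalOver (sX ≫ t) (sY ≫ t) := by
  rw [birationalOver_iff_exists_isOpenImmersion] at h ⊢
  obtain ⟨U, i, j, hi, hi', hj, hj', h⟩ := h
  exact ⟨U, i, j, hi, hi', hj, hj', by rw [reassoc_of% h]⟩

theorem exists_comp_eq_of_isOpenImmersion {E : CommRingCat.{u}} (hE : IsField E) {U X : Scheme.{u}}
    (i : U ⟶ X) [IsOpenImmersion i] [IsDominant i] (ξ : Spec E ⟶ X) [IsDominant ξ] :
    ∃ ζ : Spec E ⟶ U, ζ ≫ i = ξ := by
  let := hE.toField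
  have : Subsingleton (Spec E) := inferInstanceAs (Subsingleton (PrimeSpectrum E))
  let z : Spec E := IsLocalRing.closedPoint E
  have hU : (Set.range i).Nonempty :=
    Set.range_nonempty_iff_nonempty.mpr (i.denseRange.nonempty_iff.mpr ⟨ξ z⟩)
  obtain ⟨w, hw⟩ := ξ.denseRange.exists_mem_open i.isOpenEmbedding.isOpen_range hU
  refine ⟨IsOpenImmersion.lift i ξ ?_, IsOpenImmersion.lift_fac i ξ _⟩
  rintro _ ⟨w', rfl⟩
  exact Subsingleton.elim w w' ▸ hw

theorem exists_generic_lift_of_birationalOver {E : CommRingCat.{u}} (hE : IsField E)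
    {S X Y : Scheme.{u}} {sX : X ⟶ S} {sY : Y ⟶ S} (h : Scheme.BirationalOver sX sY)
    (ξ : Spec E ⟶ X) [IsPreimmersion ξ] [IsDominant ξ] :
    ∃ ζ : Spec E ⟶ Y, IsPreimmersion ζ ∧ IsDominant ζ ∧ ζ ≫ sY = ξ ≫ sX := by
  obtain ⟨U, i, j, _, _, _, _, h⟩ := birationalOver_iff_exists_isOpenImmersion.mp h
  obtain ⟨ξ', rfl⟩ := exists_comp_eq_of_isOpenImmersion hE i ξ
  have : IsPreimmersion ξ' := .of_comp ξ' i
  have := isDominant_of_comp_isPreimmersion ξ' i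
  exact ⟨ξ' ≫ j, inferInstance, inferInstance, by rw [Category.assoc, Category.assoc, h]⟩

end Birational

section AffineSpace

/-- An affine space over an affine space, as an affine space over the base. -/
noncomputable def affineSpaceSumIso (m N : Type u) (S : Scheme.{u}) :
    𝔸(N; 𝔸(m; S)) ≅ 𝔸(m ⊕ N; S) where
  hom := AffineSpace.homOfVector ((𝔸(N; 𝔸(m; S)) ↘ 𝔸(m; S)) ≫ (𝔸(m; S) ↘ S))
    (Sum.elim (fun i ↦ (𝔸(N; 𝔸(m; S)) ↘ 𝔸(m; S)).appTop (AffineSpace.coord S i))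
      (AffineSpace.coord 𝔸(m; S)))
  inv := AffineSpace.homOfVector (AffineSpace.reindex Sum.inl S)
    (fun j ↦ AffineSpace.coord S (Sum.inr j))
  hom_inv_id := by
    apply AffineSpace.hom_ext
    · rw [Category.assoc, AffineSpace.homOfVector_over, Category.id_comp]
      apply AffineSpace.hom_ext
      · simp
      · intro i
        rw [Scheme.Hom.comp_appTop, CommRingCat.comp_apply, AffineSpace.reindex_appTop_coord,
          AffineSpace.homOfVector_appTop_coord]
        rfl
    · intro i
      rw [Scheme.Hom.comp_appTop, CommRingCat.comp_apply, AffineSpace.homOfVector_appTop_coord,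
        AffineSpace.homOfVector_appTop_coord]
      simp
  inv_hom_id := by
    apply AffineSpace.hom_ext
    · rw [Category.assoc, AffineSpace.homOfVector_over, AffineSpace.homOfVector_over_assoc,
        AffineSpace.reindex_over, Category.id_comp]
    · rintro (i | i)
      · rw [Scheme.Hom.comp_appTop, CommRingCat.comp_apply, AffineSpace.homOfVector_appTop_coord,
          Sum.elim_inl, ← CommRingCat.comp_apply, ← Scheme.Hom.comp_appTop,
          AffineSpace.homOfVector_over, AffineSpace.reindex_appTop_coord]
        simp
      · rw [Scheme.Hom.comp_appTop, CommRingCat.comp_apply, AffineSpace.homOfVector_appTop_coord,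
          Sum.elim_inr, AffineSpace.homOfVector_appTop_coord]
        simp

theorem birationalOver_affineSpace_sum (m N : Type u) (S : Scheme.{u}) :
    Scheme.BirationalOver ((𝔸(N; 𝔸(m; S)) ↘ 𝔸(m; S)) ≫ (𝔸(m; S) ↘ S)) (𝔸(m ⊕ N; S) ↘ S) :=
  (affineSpaceSumIso m N S).hom.birationalOver _ _ (AffineSpace.homOfVector_over _ _)

theorem isIso_reindex {m N : Type u} (e : m ≃ N) (S : Scheme.{u}) :
    IsIso (AffineSpace.reindex e S) := by
  refine ⟨AffineSpace.reindex e.symm S, ?_, ?_⟩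
  · rw [← AffineSpace.reindex_id]
    exact (AffineSpace.reindex_comp (↾e.symm) (↾e) S).symm.trans (by congr 1; ext; simp)
  · rw [← AffineSpace.reindex_id]
    exact (AffineSpace.reindex_comp (↾e) (↾e.symm) S).symm.trans (by congr 1; ext; simp)

theorem birationalOver_affineSpace_of_equiv {m N : Type u} (e : m ≃ N) (S : Scheme.{u}) :
    Scheme.BirationalOver (𝔸(m; S) ↘ S) (𝔸(N; S) ↘ S) :=
  have := isIso_reindex e.symm S
  (AffineSpace.reindex e.symm S).birationalOver _ _ (AffineSpace.reindex_over _ _)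

theorem isDominant_of_isPullback {P X Y Z : Scheme.{u}} {f' : P ⟶ Y} {g' : P ⟶ X} {g : Y ⟶ Z}
    {f : X ⟶ Z} (h : IsPullback f' g' g f) (hg : IsOpenMap g) [IsDominant f] : IsDominant f' := by
  have h_range := Scheme.image_preimage_eq_of_isPullback h.flip Set.univ
  rw [Set.preimage_univ, Set.image_univ, Set.image_univ] at h_range
  exact ⟨(f.denseRange.preimage hg).mono h_range.ge⟩

theorem isDominant_affineSpaceMap (N : Type u) {S S' : Scheme.{u}} (f : S ⟶ S') [IsDominant f] :
    IsDominant (AffineSpace.map N f) :=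
  isDominant_of_isPullback (AffineSpace.isPullback_map f) (AffineSpace.isOpenMap_over _)

theorem birationalOver_affineSpace_comp (N : Type u) {S X Y : Scheme.{u}} {sX : X ⟶ S}
    {sY : Y ⟶ S} (h : Scheme.BirationalOver sX sY) :
    Scheme.BirationalOver ((𝔸(N; X) ↘ X) ≫ sX) ((𝔸(N; Y) ↘ Y) ≫ sY) := by
  rw [birationalOver_iff_exists_isOpenImmersion] at h ⊢
  obtain ⟨U, i, j, _, _, _, _, h⟩ := h
  exact ⟨𝔸(N; U), AffineSpace.map N i, AffineSpace.map N j,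
    MorphismProperty.of_isPullback (AffineSpace.isPullback_map i).flip ‹_›,
    isDominant_affineSpaceMap N i,
    MorphismProperty.of_isPullback (AffineSpace.isPullback_map j).flip ‹_›,
    isDominant_affineSpaceMap N j, by
    rw [AffineSpace.map_over_assoc, AffineSpace.map_over_assoc, h]⟩

theorem finite_of_injective_mvPolynomial {K L N : Type u} [CommRing K] [IsDomain K] [CommRing L]
    [Algebra K L] [Algebra.FiniteType K L] {φ : MvPolynomial N K →ₐ[K] L}
    (hφ : Function.Injective φ) : Finite N := by
  rw [← Cardinal.lt_aleph0_iff_finite]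
  calc Cardinal.mk N ≤ Algebra.trdeg K L :=
      ((MvPolynomial.algebraicIndependent_X N K).map' hφ).cardinalMk_le_trdeg
    _ < Cardinal.aleph0 := trdeg_lt_aleph0_of_finiteType

theorem finite_of_isDominant_affineSpace {K R : CommRingCat.{u}} [IsDomain K] {N : Type u}
    (j : Spec R ⟶ 𝔸(N; Spec K)) [IsDominant j] [LocallyOfFiniteType (j ≫ (𝔸(N; Spec K) ↘ Spec K))] :
    Finite N := by
  obtain ⟨φ, hφ⟩ := Spec.map_surjective (j ≫ (AffineSpace.SpecIso N K).hom)
  have : IsDominant (Spec.map φ) := hφ ▸ inferInstance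
  have hφ_inj : Function.Injective φ.hom := by
    rw [RingHom.injective_iff_ker_eq_bot, eq_bot_iff]
    exact ((PrimeSpectrum.denseRange_comap_iff_ker_le_nilRadical φ.hom).mp
      (Spec.map φ).denseRange).trans_eq (nilradical_eq_zero _)
  have hφ_fin : (φ.hom.comp MvPolynomial.C).FiniteType := by
    rw [← CommRingCat.hom_ofHom (φ.hom.comp MvPolynomial.C),
      ← HasRingHomProperty.Spec_iff (P := @LocallyOfFiniteType)]
    have hj : Spec.map (CommRingCat.ofHom (φ.hom.comp MvPolynomial.C)) =
        j ≫ (𝔸(N; Spec K) ↘ Spec K) := by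
      rw [CommRingCat.ofHom_comp, Spec.map_comp, ← AffineSpace.SpecIso_inv_over,
        CommRingCat.ofHom_hom, hφ, Category.assoc, Iso.hom_inv_id_assoc]
    exact hj ▸ inferInstance
  algebraize [φ.hom.comp MvPolynomial.C]
  exact finite_of_injective_mvPolynomial (φ := ⟨φ.hom, fun _ ↦ rfl⟩) hφ_inj

theorem finite_of_birationalOver_affineSpace {K : CommRingCat.{u}} [IsDomain K] {X : Scheme.{u}}
    {sX : X ⟶ Spec K} [LocallyOfFiniteType sX] {N : Type u}
    (h : Scheme.BirationalOver sX (𝔸(N; Spec K) ↘ Spec K)) : Finite N := by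
  obtain ⟨U, i, j, _, _, _, _, h⟩ := birationalOver_iff_exists_isOpenImmersion.mp h
  obtain ⟨x⟩ : Nonempty U := j.denseRange.nonempty_iff.mpr inferInstance
  obtain ⟨R, g, _, ⟨y, -⟩, -⟩ :=
    Scheme.exists_affine_mem_range_and_range_subset (TopologicalSpace.Opens.mem_top x)
  have : Nonempty (Spec R) := ⟨y⟩
  have := isDominant_of_isOpenImmersion (g ≫ j)
  have : LocallyOfFiniteType ((g ≫ j) ≫ (𝔸(N; Spec K) ↘ Spec K)) := by
    rw [Category.assoc, ← h]
    infer_instance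
  exact finite_of_isDominant_affineSpace (g ≫ j)

theorem subsingleton_of_isDominant_of_isOpenImmersion {U X : Scheme.{u}} [JacobsonSpace X]
    [Subsingleton U] (i : U ⟶ X) [IsOpenImmersion i] [IsDominant i] : Subsingleton X := by
  obtain hX | hX := isEmpty_or_nonempty X
  · infer_instance
  obtain ⟨x⟩ := i.denseRange.nonempty_iff.mpr hX
  have hx : Set.range i = {i x} := (Set.subsingleton_range i).eq_singleton_of_mem ⟨x, rfl⟩
  have hopen : IsOpen {i x} := hx ▸ i.isOpenEmbedding.isOpen_range
  have hclosed := isClosed_singleton_of_isLocallyClosed_singleton hopen.isLocallyClosed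
  rw [← Set.subsingleton_univ_iff, ← i.denseRange.closure_range, hx, hclosed.closure_eq]
  exact Set.subsingleton_singleton

theorem nonempty_of_birationalOver_affineSpace {K : CommRingCat.{u}} (hK : IsField K)
    {X : Scheme.{u}} [Nontrivial X] {sX : X ⟶ Spec K} [LocallyOfFiniteType sX] {N : Type u}
    (h : Scheme.BirationalOver sX (𝔸(N; Spec K) ↘ Spec K)) : Nonempty N := by
  let := hK.toField
  have : Subsingleton (Spec K) := inferInstanceAs (Subsingleton (PrimeSpectrum K))
  have : JacobsonSpace (Spec K) := inferInstanceAs (JacobsonSpace (PrimeSpectrum K))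
  have := LocallyOfFiniteType.jacobsonSpace sX
  obtain ⟨U, i, j, _, _, _, _, -⟩ := birationalOver_iff_exists_isOpenImmersion.mp h
  by_contra! hN
  have : Subsingleton U :=
    (j ≫ (𝔸(N; Spec K) ↘ Spec K)).isOpenEmbedding.injective.subsingleton
  exact not_subsingleton X (subsingleton_of_isDominant_of_isOpenImmersion i)

theorem exists_generic_lift_affineSpace (N : Type u) {S B X : Scheme.{u}} {i : S ⟶ B}
    [IsPreimmersion i] {l : X ⟶ S} {ξ : X ⟶ 𝔸(N; B)} [IsPreimmersion ξ] [IsDominant ξ]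
    (hl : l ≫ i = ξ ≫ (𝔸(N; B) ↘ B)) :
    ∃ ζ : X ⟶ 𝔸(N; S), IsPreimmersion ζ ∧ IsDominant ζ ∧ ζ ≫ (𝔸(N; S) ↘ S) = l := by
  have hA := AffineSpace.isPullback_map (n := N) i
  have := MorphismProperty.of_isPullback (P := @IsPreimmersion) hA.flip inferInstance
  let ζ := hA.lift ξ l hl.symm
  have hζ : ζ ≫ AffineSpace.map N i = ξ := hA.lift_fst _ _ _
  have : IsPreimmersion (ζ ≫ AffineSpace.map N i) := hζ ▸ inferInstance
  have : IsDominant (ζ ≫ AffineSpace.map N i) := hζ ▸ inferInstance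
  exact ⟨ζ, .of_comp ζ (AffineSpace.map N i),
    isDominant_of_comp_isPreimmersion ζ (AffineSpace.map N i), hA.lift_snd _ _ _⟩

end AffineSpace

section Domination

variable {k : CommRingCat.{u}} {p n : ℕ} [ExpChar k p] {T B : Scheme.{u}} [IsIntegral T]
  [IrreducibleSpace B] {sT : T ⟶ Spec k} {sB : B ⟶ Spec k} [LocallyOfFiniteType sT]

theorem purelyInseparablyDominates_of_birationalOver (hk : IsField k) {f : T ⟶ B}
    (hf : f ≫ sB = sT) [IsDominant f] [ExpChar (B.residueField (genericPoint B)) p] {N : Type u}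
    (hN : Scheme.BirationalOver (frobeniusPullback p n (f.fiberToSpecResidueField (genericPoint B)))
      (𝔸(N; Spec (B.residueField (genericPoint B))) ↘ _))
    {X : Scheme.{u}} [IsIntegral X] {sX : X ⟶ Spec k} [LocallyOfFiniteType sX]
    (hX : Scheme.BirationalOver sX ((𝔸(N; B) ↘ B) ≫ sB ≫ specFrobenius p n k)) :
    PurelyInseparablyDominates sX sT := by
  let η := genericPoint B
  let iη := B.fromSpecResidueField η
  let b := frobeniusPullback p n (f.fiberToSpecResidueField η)
  let c := pullback.fst (f.fiberToSpecResidueField η) (specFrobenius p n (B.residueField η))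
  have hC : IsPullback (c ≫ f.fiberι η) b f (specFrobenius p n _ ≫ iη) :=
    (IsPullback.of_hasPullback (f.fiberToSpecResidueField η) _).paste_horiz
      (IsPullback.of_hasPullback f iη)
  have hE := Field.toIsField X.functionField
  have hF := Field.toIsField T.functionField
  have := isDominant_fromSpecStalk_genericPoint X
  have := isDominant_fromSpecStalk_genericPoint T
  obtain ⟨ξ, _, _, hξ⟩ := exists_generic_lift_of_birationalOver hE hX (X.fromSpecStalk _)
  obtain ⟨m, hm⟩ := exists_comp_fromSpecResidueField_eq hE (ξ ≫ (𝔸(N; B) ↘ B))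
  obtain ⟨j, _, _, hj⟩ := exists_generic_lift_affineSpace N hm
  obtain ⟨g, _, _, hg⟩ := exists_generic_lift_of_birationalOver hE hN.symm j
  have := surjective_of_isField (Field.toIsField _) (specFrobenius p n (B.residueField η))
  have := isDominant_fiberι_genericPoint f
  obtain ⟨ψ, hψ⟩ := exists_SpecMap_comp_fromSpecStalk_eq hE (g ≫ c ≫ f.fiberι η)
  obtain ⟨l, hl⟩ := exists_comp_fromSpecResidueField_eq hF (T.fromSpecStalk _ ≫ f)
  have : ExpChar X.functionField p := expChar_of_hom hk (X.fromSpecStalk _ ≫ sX)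
  have : ExpChar T.functionField p := expChar_of_hom hk (T.fromSpecStalk _ ≫ sT)
  refine purelyInseparablyDominates_of_pow_mem_range hk (p := p) (n := n) (ψ := ψ) ?_
    (pow_mem_range_of_isPullback hE hF hC hψ hl)
  calc (Spec.map ψ ≫ T.fromSpecStalk _) ≫ sT
      = g ≫ ((c ≫ f.fiberι η) ≫ f) ≫ sB := by rw [hψ, ← hf]; simp only [Category.assoc]
    _ = (g ≫ b) ≫ specFrobenius p n _ ≫ iη ≫ sB := by rw [hC.w]; simp only [Category.assoc]
    _ = (m ≫ iη) ≫ sB ≫ specFrobenius p n k := by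
      rw [hg, hj, specFrobenius_comp]; simp only [Category.assoc]
    _ = X.fromSpecStalk _ ≫ sX := by rw [hm, ← hξ, Category.assoc]

end Domination

section Fibration

theorem exists_birationalOver_affineSpace_frobeniusPullback {K : CommRingCat.{u}} (hK : IsField K)
    {p n : ℕ} [ExpChar K p] {C : Scheme.{u}} {sC : C ⟶ Spec K} [LocallyOfFiniteType sC]
    (h_dim : 0 < topologicalKrullDim C) (h : Scheme.IsRationalOver (frobeniusPullback p n sC)) :
    ∃ N : Type u, Finite N ∧ Nonempty N ∧
      Scheme.BirationalOver (frobeniusPullback p n sC) (𝔸(N; Spec K) ↘ Spec K) := by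
  obtain ⟨N, hN⟩ := h.exists_birationalOver_affineSpace
  have : LocallyOfFiniteType (frobeniusPullback p n sC) :=
    inferInstanceAs (LocallyOfFiniteType (pullback.snd sC (specFrobenius p n K)))
  have : Nontrivial C := by
    by_contra! hC
    exact h_dim.not_ge (topologicalKrullDim_zero_of_discreteTopology C)
  have : Nonempty (Spec K) :=
    have := hK.nontrivial
    inferInstanceAs (Nonempty (PrimeSpectrum K))
  have := surjective_of_isField hK (specFrobenius p n K)
  have := (pullback.fst sC (specFrobenius p n K)).surjective.nontrivial
  have := hK.isDomain
  exact ⟨N, finite_of_birationalOver_affineSpace hN, nonempty_of_birationalOver_affineSpace hK hN,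
    hN⟩

variable {k : Type u} [Field k] {p n : ℕ} [ExpChar k p] [PerfectRing k p] {T B : Scheme.{u}}
  [IsIntegral T] [IrreducibleSpace B] {sT : T ⟶ Spec (.of k)} {sB : B ⟶ Spec (.of k)}
  [LocallyOfFiniteType sT] [LocallyOfFiniteType sB] {f : T ⟶ B} [IsDominant f]
  [ExpChar (B.residueField (genericPoint B)) p] {N : Type u} [Finite N]

theorem isInseparablyUniruled_of_birationalOver [IsReduced B] [IsSeparated sB] [QuasiCompact sB]
    [Nonempty N] (hf : f ≫ sB = sT)
    (hN : Scheme.BirationalOver (frobeniusPullback p n (f.fiberToSpecResidueField (genericPoint B)))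
      (𝔸(N; Spec (B.residueField (genericPoint B))) ↘ _)) :
    IsInseparablyUniruled sT := by
  classical
  have := isIntegral_of_irreducibleSpace_of_isReduced B
  obtain ⟨i₀⟩ := ‹Nonempty N›
  let N' := {i : N // i ≠ i₀}
  let e : N' ⊕ PUnit.{u + 1} ≃ N :=
    (Equiv.optionEquivSumPUnit N').symm.trans (Equiv.optionSubtypeNe i₀)
  have := isIso_specFrobenius p n (.of k)
  let sY : 𝔸(N'; B) ⟶ Spec (.of k) := (𝔸(N'; B) ↘ B) ≫ sB ≫ specFrobenius p n (.of k)
  refine ⟨𝔸(N'; B), sY, inferInstance, inferInstance, inferInstance, inferInstance, ?_⟩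
  apply purelyInseparablyDominates_of_birationalOver (Field.toIsField k) hf hN
  have h := (birationalOver_affineSpace_sum N' PUnit B).trans
    (birationalOver_affineSpace_of_equiv e B)
  simpa only [Category.assoc] using birationalOver_comp h (sB ≫ specFrobenius p n (.of k))

theorem isInseparablyUnirational_of_birationalOver (hf : f ≫ sB = sT)
    (hN : Scheme.BirationalOver (frobeniusPullback p n (f.fiberToSpecResidueField (genericPoint B)))
      (𝔸(N; Spec (B.residueField (genericPoint B))) ↘ _))
    (hB : Scheme.IsRationalOver sB) : IsInseparablyUnirational sT := by
  obtain ⟨m, hm⟩ := hB.exists_birationalOver_affineSpace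
  have : Finite m := finite_of_birationalOver_affineSpace hm
  refine ⟨m ⊕ N, inferInstance, ?_⟩
  apply purelyInseparablyDominates_of_birationalOver (Field.toIsField k) hf hN
  have := isIso_specFrobenius p n (.of k)
  let Fr := specFrobenius p n (.of k)
  have h_twist : Scheme.BirationalOver (𝔸(m ⊕ N; Spec (.of k)) ↘ Spec (.of k))
      ((𝔸(m ⊕ N; Spec (.of k)) ↘ Spec (.of k)) ≫ Fr) := by
    simpa only [Category.comp_id] using birationalOver_affineSpace_comp (m ⊕ N)
      (Fr.birationalOver (𝟙 _) Fr (Category.comp_id _)).symm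
  have h_sum : Scheme.BirationalOver (𝔸(m ⊕ N; Spec (.of k)) ↘ Spec (.of k))
      ((𝔸(N; B) ↘ B) ≫ sB) :=
    (birationalOver_affineSpace_sum m N _).symm.trans (birationalOver_affineSpace_comp N hm.symm)
  simpa only [Category.assoc] using h_twist.trans (birationalOver_comp h_sum Fr)

end Fibration

end FrobeniusFibration

open FrobeniusFibration

theorem proposition4p2_general {k : Type u} [Field k] (p : ℕ) [ExpChar k p] [PerfectRing k p]
    {T B : Scheme.{u}} (sT : T ⟶ Spec (.of k)) (sB : B ⟶ Spec (.of k))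
    [IsIntegral T] [LocallyOfFiniteType sT]
    [IsIntegral B] [IsSeparated sB] [LocallyOfFiniteType sB] [QuasiCompact sB]
    (f : T ⟶ B) (hf : f ≫ sB = sT) [IsDominant f]
    (h_dim : 0 < topologicalKrullDim (f.fiber (genericPoint B)))
    (n : ℕ)
    (h_rat :
      haveI : ExpChar (B.residueField (genericPoint B)) p :=
        expChar_of_hom (Field.toIsField k) (B.fromSpecResidueField (genericPoint B) ≫ sB)
      Scheme.IsRationalOver (frobeniusPullback p n (f.fiberToSpecResidueField (genericPoint B)))) :
    IsInseparablyUniruled sT ∧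
      (Scheme.IsRationalOver sB → IsInseparablyUnirational sT) := by
  have : ExpChar (B.residueField (genericPoint B)) p :=
    expChar_of_hom (Field.toIsField k) (B.fromSpecResidueField (genericPoint B) ≫ sB)
  have : LocallyOfFiniteType (f ≫ sB) := hf ▸ inferInstance
  have : LocallyOfFiniteType f := locallyOfFiniteType_of_comp f sB
  have : LocallyOfFiniteType (f.fiberToSpecResidueField (genericPoint B)) :=
    inferInstanceAs (LocallyOfFiniteType (pullback.snd f _))
  obtain ⟨N, _, _, hN⟩ :=
    exists_birationalOver_affineSpace_frobeniusPullback (Field.toIsField _) h_dim h_rat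
  exact ⟨isInseparablyUniruled_of_birationalOver hf hN,
    isInseparablyUnirational_of_birationalOver hf hN⟩

theorem proposition4p2 {k : Type u} [Field k] [IsAlgClosed k] (p : ℕ) [Fact p.Prime] [CharP k p]
    {T B : Scheme.{u}} (sT : T ⟶ Spec (.of k)) (sB : B ⟶ Spec (.of k))
    [IsIntegral T] [IsSeparated sT] [LocallyOfFiniteType sT] [QuasiCompact sT]
    [IsIntegral B] [IsSeparated sB] [LocallyOfFiniteType sB] [QuasiCompact sB]
    (f : T ⟶ B) (hf : f ≫ sB = sT) [IsDominant f]
    (h_reg : FrobeniusFibration.IsRegular (f.fiber (genericPoint B)))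
    (h_geom : GeometricallyIntegral (f.fiberToSpecResidueField (genericPoint B)))
    (h_dim : topologicalKrullDim (f.fiber (genericPoint B)) = 1)
    (n : ℕ)
    (h_rat :
      haveI : CharP (B.residueField (genericPoint B)) p :=
        FrobeniusFibration.charP_residueField p sB (genericPoint B)
      Scheme.IsRationalOver (FrobeniusFibration.frobeniusPullback p n
        (f.fiberToSpecResidueField (genericPoint B)))) :
    FrobeniusFibration.IsInseparablyUniruled sT ∧
      (Scheme.IsRationalOver sB → FrobeniusFibration.IsInseparablyUnirational sT) :=
  have := PerfectField.toPerfectRing (K := k) p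
  proposition4p2_general p sT sB f hf (h_dim ▸ zero_lt_one) n h_rat
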